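/- Let $H$ be the parity-check matrix of a $(3,\rho,8)$ LDPC code (the global code): a finite binary matrix whose Tanner graph (variable nodes are the columns, check nodes are the rows, $v\sim c$ iff $H_{c,v}=1$) has every variable node of degree $3$, every check node of degree $\rho$, and girth $8$. Let $K\subseteq\mathbb F_2^{\rho}$ be a linear component code with minimum distance at least $5$ (a $2$-error-correcting code). Choose a set of check nodes, called super checks, such that every variable node is adjacent to exactly two super checks, and for each super check identify its $\rho$ neighbours with the coordinates of $K$ by any bijection; the other check nodes are single parity checks. The resulting CH-GLDPC code $\mathcal C$ is the set of binary words $x$ indexed by the variable nodes such that the neighbours of each super check carry a codeword of $K$ and the values at the neighbours of each single parity check sum to $0$ modulo $2$. In each iteration of the parallel bit flipping (PBF) algorithm, every super check applies bounded distance decoding of radius $2$ to the current values of its neighbours: if there is a codeword of $K$ within Hamming distance $2$ (it is then unique), it sends a flip message to exactly those neighbours whose value differs from this codeword, and otherwise it sends none. Every single parity check sends a flip message to all its neighbours if the sum of their values is odd, and none otherwise. Then all variable nodes that received more than $3/2$ flip messages are flipped simultaneously. The algorithm stops when the current word is in $\mathcal C$ or after a maximum number $M$ of iterations. Then the PBF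 algorithm corrects up to $5$ errors in $\mathcal C$: there is an $M_0$ such that for every $M\ge M_0$, every transmitted codeword $x\in\mathcal C$ and every error pattern $e$ of Hamming weight at most $5$, the output of the PBF algorithm on the received word $x+e$ is $x$. -/

import Mathlib

open Finset

/-- The variable nodes joined to the check node `c` in the Tanner graph of `H`. -/
def varNbhd {V C : Type*} [Fintype V] (H : Matrix C V (ZMod 2)) (c : C) : Finset V :=
  univ.filter fun v => H c v = 1

/-- The check nodes joined to the variable node `v` in the Tanner graph of `H`. -/
def checkNbhd {V C : Type*} [Fintype C] (H : Matrix C V (ZMod 2)) (v : V) : Finset C :=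
  univ.filter fun c => H c v = 1

/-- The Tanner graph of a parity-check matrix `H` (rows are check nodes, columns are variable
nodes): the bipartite graph in which `v` and `c` are adjacent if and only if `H c v = 1`. -/
def tannerGraph {V C : Type*} (H : Matrix C V (ZMod 2)) : SimpleGraph (V ⊕ C) where
  Adj a b := match a, b with
    | .inl v, .inr c => H c v = 1
    | .inr c, .inl v => H c v = 1
    | _, _ => False
  symm := ⟨by rintro (v | c) (v' | c') h <;> exact h⟩
  loopless := ⟨by rintro (v | c) h <;> exact h⟩

/-- `H` is the parity-check matrix of a `(γ, ρ, g)` LDPC code: its Tanner graph is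
`(γ, ρ)`-regular and has girth `g`. -/
structure IsLDPC {V C : Type*} [Fintype V] [Fintype C]
    (H : Matrix C V (ZMod 2)) (γ ρ g : ℕ) : Prop where
  var_degree : ∀ v, (checkNbhd H v).card = γ
  check_degree : ∀ c, (varNbhd H c).card = ρ
  girth_eq : (tannerGraph H).egirth = (g : ℕ∞)

/-- A binary linear code of length `ρ` is `t`-error-correcting: its minimum distance is at
least `2 t + 1`. -/
def IsErrorCorrecting {ρ : ℕ} (K : Submodule (ZMod 2) (Fin ρ → ZMod 2)) (t : ℕ) : Prop :=
  ∀ x ∈ K, ∀ y ∈ K, x ≠ y → 2 * t + 1 ≤ hammingDist x y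

open Classical in
/-- Bounded distance decoding of radius `t`: return a codeword at Hamming distance at most `t`
from `w` if there is one (it is unique if the code is `t`-error-correcting), otherwise fail. -/
noncomputable def bdd {ρ : ℕ} (K : Submodule (ZMod 2) (Fin ρ → ZMod 2)) (t : ℕ)
    (w : Fin ρ → ZMod 2) : Option (Fin ρ → ZMod 2) :=
  if h : ∃ z ∈ K, hammingDist z w ≤ t then some h.choose else none

/-- The data of a check-hybrid GLDPC code: the parity-check matrix of the global code, the set of
check nodes that are super checks (all others are single parity checks), the component code, and,
for each super check, the assignment of the `ρ` coordinates of the component code to its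
neighbouring variable nodes. -/
structure CHGLDPC (V C : Type*) [Fintype V] (ρ : ℕ) where
  H : Matrix C V (ZMod 2)
  super : Set C
  comp : Submodule (ZMod 2) (Fin ρ → ZMod 2)
  coord : ∀ c : super, Fin ρ ≃ {v // v ∈ varNbhd H c}

namespace CHGLDPC

variable {V C : Type*} [Fintype V] {ρ : ℕ}

/-- The values of the neighbours of a super check, read in the order of the component code. -/
def localWord (𝒞 : CHGLDPC V C ρ) (y : V → ZMod 2) (c : 𝒞.super) : Fin ρ → ZMod 2 :=
  fun i => y (𝒞.coord c i)

/-- The codewords: every super check sees a codeword of the component code and every single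
parity check sees an even number of ones. -/
def code (𝒞 : CHGLDPC V C ρ) : Set (V → ZMod 2) :=
  {x | (∀ c : 𝒞.super, 𝒞.localWord x c ∈ 𝒞.comp) ∧
    ∀ c ∉ 𝒞.super, ∑ v ∈ varNbhd 𝒞.H c, x v = 0}

/-- The super check `c` sends a flip message to `v`: bounded distance decoding of radius `t`
finds a codeword and that codeword differs from `y` at `v`. -/
def SuperFlip (𝒞 : CHGLDPC V C ρ) (t : ℕ) (y : V → ZMod 2) (c : 𝒞.super) (v : V) : Prop :=
  ∃ z, bdd 𝒞.comp t (𝒞.localWord y c) = some z ∧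
    ∃ i, (𝒞.coord c i : V) = v ∧ z i ≠ y v

/-- The single parity check `c` sends a flip message to `v`: they are adjacent and the parity at
`c` is odd. -/
def SingleFlip (𝒞 : CHGLDPC V C ρ) (y : V → ZMod 2) (c : C) (v : V) : Prop :=
  v ∈ varNbhd 𝒞.H c ∧ ∑ u ∈ varNbhd 𝒞.H c, y u ≠ 0

/-- The check node `c` sends a flip message to the variable node `v`. -/
def SendsFlip (𝒞 : CHGLDPC V C ρ) (t : ℕ) (y : V → ZMod 2) (c : C) (v : V) : Prop :=
  (∃ h : c ∈ 𝒞.super, 𝒞.SuperFlip t y ⟨c, h⟩ v) ∨ (c ∉ 𝒞.super ∧ 𝒞.SingleFlip y c v)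

open Classical in
/-- One iteration of parallel bit flipping: every variable node that receives more than `γ / 2`
flip messages is flipped, all at the same time. -/
noncomputable def pbfStep [Fintype C] (𝒞 : CHGLDPC V C ρ) (γ t : ℕ) (y : V → ZMod 2) :
    V → ZMod 2 := fun v =>
  if γ < 2 * (univ.filter fun c => 𝒞.SendsFlip t y c v).card then y v + 1 else y v

open Classical in
/-- The parallel bit flipping decoder: iterate until a codeword is found or the maximum number
of iterations is reached. The arguments after the code are the column weight `γ`, the decoding
radius `t` at the super checks, the maximum number of iterations and the received word. -/
noncomputable def pbf [Fintype C] (𝒞 : CHGLDPC V C ρ) (γ t : ℕ) :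
    ℕ → (V → ZMod 2) → V → ZMod 2
  | 0, y => y
  | M + 1, y => if y ∈ 𝒞.code then y else pbf 𝒞 γ t M (𝒞.pbfStep γ t y)

end CHGLDPC

/-! Two iterations suffice: the first leaves at most two errors, the second none. A super check with
at most two errors sends exactly the right messages, and so does a single check towards `v` when its
other neighbours are correct. Two right checks out of three decide `v`. Hence a node wrong after an
iteration lies on an overloaded super check (three or more errors), and on a second one or on a
single check with another error (`exists_super_of_pbfStep_ne`). With five errors, two overloaded
super checks cover all errors and share exactly one, and the girth forces every surviving error to
be that one. If only one is overloaded, at most two errors lie off it, and single checks map the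
surviving errors injectively to these (`card_errors_pbfStep_le_two`). -/

section TannerGraph

/-! ### Short cycles excluded by the girth. -/

variable {V C : Type*} {H : Matrix C V (ZMod 2)}

/-- A Tanner graph without 4-cycles: two variable nodes share at most one check node. -/
theorem eq_of_common_checks (hg : (8 : ℕ∞) ≤ (tannerGraph H).egirth) {u v : V} {c d : C}
    (hcd : c ≠ d) (huc : H c u = 1) (hvc : H c v = 1) (hud : H d u = 1) (hvd : H d v = 1) :
    u = v := by
  by_contra huv
  have h1 : (tannerGraph H).Adj (.inl u) (.inr c) := huc
  have h2 : (tannerGraph H).Adj (.inr c) (.inl v) := hvc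
  have h3 : (tannerGraph H).Adj (.inl v) (.inr d) := hvd
  have h4 : (tannerGraph H).Adj (.inr d) (.inl u) := hud
  have hcyc : (SimpleGraph.Walk.cons h1 (.cons h2 (.cons h3 (.cons h4 .nil)))).IsCycle := by
    rw [SimpleGraph.Walk.cons_isCycle_iff]
    simp [SimpleGraph.Walk.cons_isPath_iff, hcd, huv, Ne.symm huv]
  have h := SimpleGraph.le_egirth.1 hg _ _ hcyc
  simp only [SimpleGraph.Walk.length_cons, SimpleGraph.Walk.length_nil] at h
  norm_cast at h

/-- A Tanner graph without 6-cycles: no three variable nodes share three different check nodes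
pairwise. -/
theorem not_common_checks_three (hg : (8 : ℕ∞) ≤ (tannerGraph H).egirth) {u v w : V} {a b c : C}
    (huv : u ≠ v) (hvw : v ≠ w) (huw : u ≠ w) (hab : a ≠ b) (hbc : b ≠ c) (hac : a ≠ c)
    (hau : H a u = 1) (hav : H a v = 1) (hbv : H b v = 1) (hbw : H b w = 1)
    (hcw : H c w = 1) (hcu : H c u = 1) : False := by
  have h1 : (tannerGraph H).Adj (.inl u) (.inr a) := hau
  have h2 : (tannerGraph H).Adj (.inr a) (.inl v) := hav
  have h3 : (tannerGraph H).Adj (.inl v) (.inr b) := hbv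
  have h4 : (tannerGraph H).Adj (.inr b) (.inl w) := hbw
  have h5 : (tannerGraph H).Adj (.inl w) (.inr c) := hcw
  have h6 : (tannerGraph H).Adj (.inr c) (.inl u) := hcu
  have hcyc : (SimpleGraph.Walk.cons h1 (.cons h2 (.cons h3 (.cons h4
      (.cons h5 (.cons h6 .nil)))))).IsCycle := by
    rw [SimpleGraph.Walk.cons_isCycle_iff]
    simp [SimpleGraph.Walk.cons_isPath_iff, huv, hvw, huw, hab, hbc, hac, huv.symm,
      huw.symm]
  have h := SimpleGraph.le_egirth.1 hg _ _ hcyc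
  simp only [SimpleGraph.Walk.length_cons, SimpleGraph.Walk.length_nil] at h
  norm_cast at h

end TannerGraph

/-! ### Reliable messages from lightly loaded checks. -/

/-- Bounded distance decoding finds the codeword within the decoding radius. -/
theorem bdd_eq_some {ρ t : ℕ} {K : Submodule (ZMod 2) (Fin ρ → ZMod 2)}
    (hK : IsErrorCorrecting K t) {z w : Fin ρ → ZMod 2} (hz : z ∈ K)
    (hzw : hammingDist z w ≤ t) : bdd K t w = some z := by
  have h : ∃ z ∈ K, hammingDist z w ≤ t := ⟨z, hz, hzw⟩
  rw [bdd, dif_pos h, Option.some_inj]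
  by_contra hne
  have h1 := hK _ h.choose_spec.1 z hz hne
  have h2 := hammingDist_triangle h.choose w z
  have h3 := h.choose_spec.2
  rw [hammingDist_comm w z] at h2
  omega

namespace CHGLDPC

variable {V C : Type*} [Fintype V] {ρ : ℕ}

/-- The variable nodes at which the words `x` and `y` differ. -/
def errors (x y : V → ZMod 2) : Finset V := univ.filter fun v => y v ≠ x v

theorem mem_errors {x y : V → ZMod 2} {v : V} : v ∈ errors x y ↔ y v ≠ x v := by
  simp [errors]

open Classical in
/-- The errors among the neighbours of the check node `c`. -/
noncomputable def errorsAt (𝒞 : CHGLDPC V C ρ) (x y : V → ZMod 2) (c : C) : Finset V :=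
  (errors x y).filter fun v => 𝒞.H c v = 1

theorem mem_errorsAt {𝒞 : CHGLDPC V C ρ} {x y : V → ZMod 2} {c : C} {v : V} :
    v ∈ 𝒞.errorsAt x y c ↔ y v ≠ x v ∧ 𝒞.H c v = 1 := by
  simp [errorsAt, mem_errors]

/-- Injectivity of `coord` gives this bound, which places the transmitted local word within the
decoding radius. -/
theorem hammingDist_localWord_le (𝒞 : CHGLDPC V C ρ) (x y : V → ZMod 2) (c : 𝒞.super) :
    hammingDist (𝒞.localWord x c) (𝒞.localWord y c) ≤ (𝒞.errorsAt x y c).card := by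
  refine Finset.card_le_card_of_injOn (fun i => (𝒞.coord c i : V)) ?_ ?_
  · intro i hi
    have h : 𝒞.localWord x c i ≠ 𝒞.localWord y c i := (mem_filter.1 (mem_coe.1 hi)).2
    exact mem_errorsAt.2 ⟨h.symm, (mem_filter.1 (𝒞.coord c i).2).2⟩
  · intro i _ j _ hij
    exact (𝒞.coord c).injective (Subtype.ext hij)

/-- A super check with at most `t` errors sends flip messages exactly to the errors. -/
theorem sendsFlip_iff_of_super {𝒞 : CHGLDPC V C ρ} {t : ℕ} (hK : IsErrorCorrecting 𝒞.comp t)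
    {x y : V → ZMod 2} (hx : x ∈ 𝒞.code) {c : C} (hc : c ∈ 𝒞.super)
    (hd : (𝒞.errorsAt x y c).card ≤ t) {v : V} (hv : 𝒞.H c v = 1) :
    𝒞.SendsFlip t y c v ↔ y v ≠ x v := by
  have hb : bdd 𝒞.comp t (𝒞.localWord y ⟨c, hc⟩) = some (𝒞.localWord x ⟨c, hc⟩) :=
    bdd_eq_some hK (hx.1 _) ((𝒞.hammingDist_localWord_le x y ⟨c, hc⟩).trans hd)
  constructor
  · rintro (⟨_, z, hz, i, rfl, hi⟩ | ⟨h, _⟩)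
    · rw [hb, Option.some_inj] at hz
      subst hz
      exact fun h => hi h.symm
    · exact absurd hc h
  · intro h
    refine Or.inl ⟨hc, _, hb, (𝒞.coord ⟨c, hc⟩).symm ⟨v, by simp [varNbhd, hv]⟩, by simp, ?_⟩
    simpa [localWord] using h.symm

/-- A single parity check whose other neighbours are correct sends a flip message to `v` exactly
if `v` is an error. -/
theorem sendsFlip_iff_of_single {𝒞 : CHGLDPC V C ρ} {t : ℕ} {x y : V → ZMod 2}
    (hx : x ∈ 𝒞.code) {c : C} (hc : c ∉ 𝒞.super) {v : V} (hv : 𝒞.H c v = 1)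
    (h : ∀ u, 𝒞.H c u = 1 → u ≠ v → y u = x u) :
    𝒞.SendsFlip t y c v ↔ y v ≠ x v := by
  have hmem : v ∈ varNbhd 𝒞.H c := by simp [varNbhd, hv]
  have hsum : ∑ u ∈ varNbhd 𝒞.H c, y u = y v - x v := by
    rw [← sub_zero (∑ u ∈ varNbhd 𝒞.H c, y u), ← hx.2 c hc, ← Finset.sum_sub_distrib]
    refine Finset.sum_eq_single_of_mem v hmem fun u hu huv => ?_
    rw [h u (by simpa [varNbhd] using hu) huv, sub_self]
  simp [SendsFlip, SingleFlip, hc, hmem, hsum, sub_eq_zero]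

theorem SendsFlip.adj {𝒞 : CHGLDPC V C ρ} {t : ℕ} {y : V → ZMod 2} {c : C} {v : V}
    (h : 𝒞.SendsFlip t y c v) : 𝒞.H c v = 1 := by
  rcases h with ⟨hc, z, _, i, rfl, _⟩ | ⟨_, h, _⟩
  · exact (mem_filter.1 (𝒞.coord ⟨c, hc⟩ i).2).2
  · simpa [varNbhd] using h

/-- Two different check nodes share at most one error. -/
theorem card_errorsAt_inter_le_one [DecidableEq V] {𝒞 : CHGLDPC V C ρ}
    (hg : (8 : ℕ∞) ≤ (tannerGraph 𝒞.H).egirth) (x y : V → ZMod 2) {s s' : C} (hs : s ≠ s') :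
    (𝒞.errorsAt x y s ∩ 𝒞.errorsAt x y s').card ≤ 1 := by
  refine Finset.card_le_one.2 fun u hu v hv => ?_
  simp only [mem_inter, mem_errorsAt] at hu hv
  exact eq_of_common_checks hg hs hu.1.2 hv.1.2 hu.2.2 hv.2.2

/-! ### Majority decision at a variable node. -/

variable [Fintype C]

/-- If two of the three check nodes at `v` send a flip message exactly if `v` is an error, then `v`
is correct after the iteration. -/
theorem pbfStep_eq_of_two {𝒞 : CHGLDPC V C ρ} {t : ℕ} {x y : V → ZMod 2} {v : V}
    (hdeg : (checkNbhd 𝒞.H v).card = 3) {a b : C} (hab : a ≠ b)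
    (ha : 𝒞.H a v = 1) (hb : 𝒞.H b v = 1)
    (hfa : 𝒞.SendsFlip t y a v ↔ y v ≠ x v) (hfb : 𝒞.SendsFlip t y b v ↔ y v ≠ x v) :
    𝒞.pbfStep 3 t y v = x v := by
  classical
  by_cases h : y v = x v
  -- Only the third check can send a message, and one is not more than 3/2.
  · have hsub : (univ.filter fun c => 𝒞.SendsFlip t y c v) ⊆
        ((checkNbhd 𝒞.H v).erase a).erase b := by
      intro c hc
      simp only [mem_filter, mem_univ, true_and] at hc
      simp only [mem_erase, checkNbhd, mem_filter, mem_univ, true_and]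
      refine ⟨?_, ?_, hc.adj⟩
      · rintro rfl
        exact hfb.1 hc h
      · rintro rfl
        exact hfa.1 hc h
    have hcard := Finset.card_le_card hsub
    rw [card_erase_of_mem (by simp [checkNbhd, hb, hab.symm]),
      card_erase_of_mem (by simp [checkNbhd, ha]), hdeg] at hcard
    rw [pbfStep, if_neg, h]
    convert (show ¬ 3 < 2 * (univ.filter fun c => 𝒞.SendsFlip t y c v).card by omega)
  · have hsub : ({a, b} : Finset C) ⊆ univ.filter fun c => 𝒞.SendsFlip t y c v := by
      intro c hc
      simp only [mem_insert, mem_singleton] at hc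
      rcases hc with rfl | rfl <;> simp [hfa, hfb, h]
    have hcard := Finset.card_le_card hsub
    rw [card_pair hab] at hcard
    rw [pbfStep, if_pos]
    · generalize y v = p at h
      generalize x v = q at h
      revert p q
      decide
    · convert (show 3 < 2 * (univ.filter fun c => 𝒞.SendsFlip t y c v).card by omega)

/-- The three check nodes at a variable node: two super checks and a single parity check. -/
theorem exists_checks {𝒞 : CHGLDPC V C ρ} {v : V} (hdeg : (checkNbhd 𝒞.H v).card = 3)
    (hsuper : {c : C | c ∈ 𝒞.super ∧ c ∈ checkNbhd 𝒞.H v}.ncard = 2) :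
    ∃ a b p : C, a ≠ b ∧ a ∈ 𝒞.super ∧ b ∈ 𝒞.super ∧ p ∉ 𝒞.super ∧
      𝒞.H a v = 1 ∧ 𝒞.H b v = 1 ∧ 𝒞.H p v = 1 := by
  classical
  obtain ⟨a, b, hab, hset⟩ := Set.ncard_eq_two.1 hsuper
  have hmem : ∀ c, (c ∈ 𝒞.super ∧ 𝒞.H c v = 1) ↔ (c = a ∨ c = b) := fun c => by
    simpa [checkNbhd] using Set.ext_iff.1 hset c
  have ha := (hmem a).2 (Or.inl rfl)
  have hb := (hmem b).2 (Or.inr rfl)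
  obtain ⟨p, hp, hpab⟩ : ∃ p ∈ checkNbhd 𝒞.H v, p ∉ ({a, b} : Finset C) := by
    refine Finset.exists_mem_notMem_of_card_lt_card ?_
    rw [card_pair hab, hdeg]
    norm_num
  simp only [mem_insert, mem_singleton] at hpab
  simp only [checkNbhd, mem_filter, mem_univ, true_and] at hp
  exact ⟨a, b, p, hab, ha.1, hb.1, fun h => hpab ((hmem p).1 ⟨h, hp⟩), ha.2, hb.2, hp⟩

/-- A variable node that is wrong after an iteration is adjacent to a super check `s` with more
than two errors; if it is adjacent to no other such super check, then its single parity check has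
an error elsewhere. -/
theorem exists_super_of_pbfStep_ne {𝒞 : CHGLDPC V C ρ} (hK : IsErrorCorrecting 𝒞.comp 2)
    {x y : V → ZMod 2} (hx : x ∈ 𝒞.code) {v : V} (hdeg : (checkNbhd 𝒞.H v).card = 3)
    (hsuper : {c : C | c ∈ 𝒞.super ∧ c ∈ checkNbhd 𝒞.H v}.ncard = 2)
    (hv : 𝒞.pbfStep 3 2 y v ≠ x v) :
    ∃ s ∈ 𝒞.super, 2 < (𝒞.errorsAt x y s).card ∧ 𝒞.H s v = 1 ∧
      ((∃ s' ∈ 𝒞.super, s' ≠ s ∧ 2 < (𝒞.errorsAt x y s').card ∧ 𝒞.H s' v = 1) ∨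
        ∃ p ∉ 𝒞.super, 𝒞.H p v = 1 ∧ ∃ u, u ≠ v ∧ 𝒞.H p u = 1 ∧ y u ≠ x u) := by
  obtain ⟨a, b, p, hab, ha, hb, hp, hav, hbv, hpv⟩ := exists_checks hdeg hsuper
  -- A reliable super check forces the single check to be unreliable, since two reliable checks
  -- would settle `v`.
  have key : ∀ c ∈ 𝒞.super, 𝒞.H c v = 1 → (𝒞.errorsAt x y c).card ≤ 2 →
      ∃ u, u ≠ v ∧ 𝒞.H p u = 1 ∧ y u ≠ x u := by
    intro c hc hcv hcard
    by_contra! hno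
    have hcp : c ≠ p := fun h => hp (h ▸ hc)
    exact hv (pbfStep_eq_of_two hdeg hcp hcv hpv (sendsFlip_iff_of_super hK hx hc hcard hcv)
      (sendsFlip_iff_of_single hx hp hpv fun u hu huv => hno u huv hu))
  by_cases hda : 2 < (𝒞.errorsAt x y a).card
  · refine ⟨a, ha, hda, hav, ?_⟩
    by_cases hdb : 2 < (𝒞.errorsAt x y b).card
    · exact Or.inl ⟨b, hb, hab.symm, hdb, hbv⟩
    · exact Or.inr ⟨p, hp, hpv, key b hb hbv (not_lt.1 hdb)⟩
  · by_cases hdb : 2 < (𝒞.errorsAt x y b).card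
    · exact ⟨b, hb, hdb, hbv, Or.inr ⟨p, hp, hpv, key a ha hav (not_lt.1 hda)⟩⟩
    · exact absurd (pbfStep_eq_of_two hdeg hab hav hbv
        (sendsFlip_iff_of_super hK hx ha (not_lt.1 hda) hav)
        (sendsFlip_iff_of_super hK hx hb (not_lt.1 hdb) hbv)) hv

/-- A codeword is a fixed point of the iteration. -/
theorem pbfStep_of_mem_code {𝒞 : CHGLDPC V C ρ} {t : ℕ} (hK : IsErrorCorrecting 𝒞.comp t)
    {x : V → ZMod 2} (hx : x ∈ 𝒞.code) (γ : ℕ) : 𝒞.pbfStep γ t x = x := by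
  classical
  funext v
  have hno : ∀ c, ¬ 𝒞.SendsFlip t x c v := by
    intro c h
    by_cases hc : c ∈ 𝒞.super
    · exact (sendsFlip_iff_of_super hK hx hc (by simp [errorsAt, errors]) h.adj).1 h rfl
    · exact (sendsFlip_iff_of_single hx hc h.adj fun _ _ _ => rfl).1 h rfl
  simp [pbfStep, hno]

/-! ### Error counts over one iteration. -/

/-- At most two errors are corrected in one iteration. -/
theorem pbfStep_eq_of_card_errors_le_two {𝒞 : CHGLDPC V C ρ}
    (hdeg : ∀ v, (checkNbhd 𝒞.H v).card = 3) (hK : IsErrorCorrecting 𝒞.comp 2)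
    (hsuper : ∀ v : V, {c : C | c ∈ 𝒞.super ∧ c ∈ checkNbhd 𝒞.H v}.ncard = 2)
    {x y : V → ZMod 2} (hx : x ∈ 𝒞.code) (h : (errors x y).card ≤ 2) :
    𝒞.pbfStep 3 2 y = x := by
  classical
  funext v
  by_contra hv
  obtain ⟨s, -, hs, -⟩ := exists_super_of_pbfStep_ne hK hx (hdeg v) (hsuper v) hv
  have := Finset.card_le_card (Finset.filter_subset (fun v => 𝒞.H s v = 1) (errors x y))
  unfold errorsAt at hs
  omega

/-- One iteration reduces at most five errors to at most two. -/
theorem card_errors_pbfStep_le_two {𝒞 : CHGLDPC V C ρ}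
    (hg : (8 : ℕ∞) ≤ (tannerGraph 𝒞.H).egirth)
    (hdeg : ∀ v, (checkNbhd 𝒞.H v).card = 3) (hK : IsErrorCorrecting 𝒞.comp 2)
    (hsuper : ∀ v : V, {c : C | c ∈ 𝒞.super ∧ c ∈ checkNbhd 𝒞.H v}.ncard = 2)
    {x y : V → ZMod 2} (hx : x ∈ 𝒞.code) (h : (errors x y).card ≤ 5) :
    (errors x (𝒞.pbfStep 3 2 y)).card ≤ 2 := by
  classical
  have hsub : ∀ c, 𝒞.errorsAt x y c ⊆ errors x y := fun c => Finset.filter_subset _ _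
  by_cases htwo : ∃ s ∈ 𝒞.super, ∃ s' ∈ 𝒞.super, s ≠ s' ∧
      2 < (𝒞.errorsAt x y s).card ∧ 2 < (𝒞.errorsAt x y s').card
  · obtain ⟨s, hs, s', hs', hne, hcs, hcs'⟩ := htwo
    -- The union has at least 3 + 3 - 1 = 5 elements, so every inequality is tight.
    have hinter := card_errorsAt_inter_le_one hg x y hne
    have hunion := Finset.card_union_add_card_inter (𝒞.errorsAt x y s) (𝒞.errorsAt x y s')
    have hle := Finset.card_le_card (union_subset (hsub s) (hsub s'))
    have hcov : 𝒞.errorsAt x y s ∪ 𝒞.errorsAt x y s' = errors x y :=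
      Finset.eq_of_subset_of_card_le (union_subset (hsub s) (hsub s')) (by omega)
    obtain ⟨m, hm⟩ := Finset.card_eq_one.1
      (show (𝒞.errorsAt x y s ∩ 𝒞.errorsAt x y s').card = 1 by omega)
    have hmm : m ∈ 𝒞.errorsAt x y s ∩ 𝒞.errorsAt x y s' := by simp [hm]
    simp only [mem_inter, mem_errorsAt] at hmm
    -- A third check meets each of `s` and `s'` in at most one error, and these two cover all
    -- errors.
    have honly : ∀ c, 2 < (𝒞.errorsAt x y c).card → c = s ∨ c = s' := by
      intro c hc
      by_contra! hcne
      have h1 := card_errorsAt_inter_le_one hg x y hcne.1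
      have h2 := card_errorsAt_inter_le_one hg x y hcne.2
      have h3 : 𝒞.errorsAt x y c = (𝒞.errorsAt x y c ∩ 𝒞.errorsAt x y s) ∪
          (𝒞.errorsAt x y c ∩ 𝒞.errorsAt x y s') := by
        rw [← Finset.inter_union_distrib_left, hcov, Finset.inter_eq_left.2 (hsub c)]
      have h4 := Finset.card_union_le (𝒞.errorsAt x y c ∩ 𝒞.errorsAt x y s)
        (𝒞.errorsAt x y c ∩ 𝒞.errorsAt x y s')
      rw [← h3] at h4
      omega
    -- The error `u` on the single check `p` is not on `a`, hence is on `b`. Unless `v = m`, the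
    -- nodes `u`, `v`, `m` and checks `p`, `a`, `b` form a 6-cycle. Both orders of `s`, `s'` are
    -- needed.
    have hsingle : ∀ a b : C, a ∈ 𝒞.super → b ∈ 𝒞.super → a ≠ b → 𝒞.H a m = 1 → 𝒞.H b m = 1 →
        (∀ u, y u ≠ x u → 𝒞.H a u = 1 ∨ 𝒞.H b u = 1) → ∀ v, 𝒞.H a v = 1 →
        (∃ p ∉ 𝒞.super, 𝒞.H p v = 1 ∧ ∃ u, u ≠ v ∧ 𝒞.H p u = 1 ∧ y u ≠ x u) → v = m := by
      rintro a b ha hb hab ham hbm hE v hav ⟨p, hp, hpv, u, huv, hpu, hu⟩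
      have hap : a ≠ p := fun h => hp (h ▸ ha)
      have hbp : b ≠ p := fun h => hp (h ▸ hb)
      have hau : ¬ 𝒞.H a u = 1 := fun hau => huv (eq_of_common_checks hg hap hau hav hpu hpv)
      have hbu := (hE u hu).resolve_left hau
      have hum : u ≠ m := by
        rintro rfl
        exact hau ham
      by_contra hvm
      exact not_common_checks_three hg huv hvm hum hap.symm hab hbp.symm hpu hpv hav ham hbm hbu
    have hE : ∀ u, y u ≠ x u → 𝒞.H s u = 1 ∨ 𝒞.H s' u = 1 := by
      intro u hu
      have hu' := mem_errors.2 hu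
      rw [← hcov, mem_union, mem_errorsAt, mem_errorsAt] at hu'
      exact hu'.imp And.right And.right
    refine (Finset.card_le_card (t := {m}) fun v hv => ?_).trans (by simp)
    rw [mem_singleton]
    obtain ⟨r, hr, hcr, hrv, ⟨r', hr', hrr', hcr', hrv'⟩ | hsing⟩ :=
      exists_super_of_pbfStep_ne hK hx (hdeg v) (hsuper v) (mem_errors.1 hv)
    · rcases honly r hcr with rfl | rfl <;> rcases honly r' hcr' with rfl | rfl
      · exact absurd rfl hrr'
      · exact eq_of_common_checks hg hne hrv hmm.1.2 hrv' hmm.2.2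
      · exact eq_of_common_checks hg hne hrv' hmm.1.2 hrv hmm.2.2
      · exact absurd rfl hrr'
    · rcases honly r hcr with rfl | rfl
      · exact hsingle r s' hs hs' hne hmm.1.2 hmm.2.2 hE v hrv hsing
      · exact hsingle r s hs' hs hne.symm hmm.2.2 hmm.1.2 (fun u hu => (hE u hu).symm) v hrv hsing
  · push Not at htwo
    by_cases hone : ∃ s ∈ 𝒞.super, 2 < (𝒞.errorsAt x y s).card
    · obtain ⟨s, hs, hcs⟩ := hone
      have honly : ∀ r ∈ 𝒞.super, 2 < (𝒞.errorsAt x y r).card → r = s := by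
        intro r hr hcr
        by_contra hrs
        exact absurd hcs (not_lt.2 (htwo r hr s hs hrs hcr))
      have hF : (errors x y \ 𝒞.errorsAt x y s).card ≤ 2 := by
        rw [Finset.card_sdiff_of_subset (hsub s)]
        omega
      have key : ∀ v ∈ errors x (𝒞.pbfStep 3 2 y), 𝒞.H s v = 1 ∧
          ∃ u ∈ errors x y \ 𝒞.errorsAt x y s, ∃ p ∉ 𝒞.super, 𝒞.H p v = 1 ∧ 𝒞.H p u = 1 := by
        intro v hv
        obtain ⟨r, hr, hcr, hrv, ⟨r', hr', hrr', hcr', -⟩ | ⟨p, hp, hpv, u, huv, hpu, hu⟩⟩ :=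
          exists_super_of_pbfStep_ne hK hx (hdeg v) (hsuper v) (mem_errors.1 hv)
        · exact absurd ((honly r' hr' hcr').trans (honly r hr hcr).symm) hrr'
        · obtain rfl := honly r hr hcr
          refine ⟨hrv, u, ?_, p, hp, hpv, hpu⟩
          simp only [mem_sdiff, mem_errors, mem_errorsAt, not_and]
          have hrp : r ≠ p := fun h => hp (h ▸ hr)
          exact ⟨hu, fun _ hru => huv (eq_of_common_checks hg hrp hru hrv hpu hpv)⟩
      refine le_trans ?_ hF
      -- Each outside error accounts for at most one surviving error: its single check is unique,
      -- and two survivors sharing both that check and `s` would close a 4-cycle.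
      refine Finset.card_le_card_of_forall_subsingleton
        (fun v u => ∃ p ∉ 𝒞.super, 𝒞.H p v = 1 ∧ 𝒞.H p u = 1) (fun v hv => (key v hv).2) ?_
      rintro u - v ⟨hv, p, hp, hpv, hpu⟩ w ⟨hw, q, hq, hqw, hqu⟩
      obtain ⟨a, b, -, hab, ha, hb, -, hau, hbu, -⟩ := exists_checks (hdeg u) (hsuper u)
      have hpq : p = q := by
        by_contra hpq
        -- Two super checks and two distinct single checks would exceed the degree 3 of `u`.
        have hsub4 : ({a, b, p, q} : Finset C) ⊆ checkNbhd 𝒞.H u := by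
          intro c hc
          simp only [mem_insert, mem_singleton] at hc
          rcases hc with rfl | rfl | rfl | rfl <;> simp [checkNbhd, *]
        have hcard := Finset.card_le_card hsub4
        have hap : a ≠ p := fun h => hp (h ▸ ha)
        have haq : a ≠ q := fun h => hq (h ▸ ha)
        have hbp : b ≠ p := fun h => hp (h ▸ hb)
        have hbq : b ≠ q := fun h => hq (h ▸ hb)
        rw [hdeg u, card_insert_of_notMem (by simp [*]), card_insert_of_notMem (by simp [*]),
          card_pair hpq] at hcard
        omega
      subst hpq
      have hsp : s ≠ p := fun h => hp (h ▸ hs)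
      exact eq_of_common_checks hg hsp (key v hv).1 (key w hw).1 hpv hqw
    · have hempty : errors x (𝒞.pbfStep 3 2 y) = ∅ := by
        refine Finset.eq_empty_of_forall_notMem fun v hv => hone ?_
        obtain ⟨s, hs, hcs, -⟩ :=
          exists_super_of_pbfStep_ne hK hx (hdeg v) (hsuper v) (mem_errors.1 hv)
        exact ⟨s, hs, hcs⟩
      simp [hempty]

/-! ### From iterates to the decoder. -/

/-- If `n` iterations lead to the codeword `x`, then so does the decoder with at least `n`
iterations. -/
theorem pbf_eq_of_iterate {𝒞 : CHGLDPC V C ρ} {γ t : ℕ} (hK : IsErrorCorrecting 𝒞.comp t)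
    {x : V → ZMod 2} (hx : x ∈ 𝒞.code) {n M : ℕ} (hM : n ≤ M) {y : V → ZMod 2}
    (h : (𝒞.pbfStep γ t)^[n] y = x) : 𝒞.pbf γ t M y = x := by
  induction M generalizing n y with
  | zero =>
    obtain rfl : n = 0 := by omega
    exact h
  | succ M ih =>
    rw [pbf]
    split_ifs with hy
    -- Early stopping is harmless: a codeword `y` is fixed by the iteration, so it already equals
    -- `x`.
    · rwa [Function.iterate_fixed (pbfStep_of_mem_code hK hy γ)] at h
    · cases n with
      | zero => exact absurd (by rwa [show y = x from h]) hy
      | succ n => exact ih (by omega) h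

end CHGLDPC

theorem mainTheorem1 {V C : Type*} [Fintype V] [Fintype C] (ρ : ℕ) (𝒞 : CHGLDPC V C ρ)
    (hglobal : IsLDPC 𝒞.H 3 ρ 8)
    (hcomp : IsErrorCorrecting 𝒞.comp 2)
    (hsuper : ∀ v : V, {c : C | c ∈ 𝒞.super ∧ c ∈ checkNbhd 𝒞.H v}.ncard = 2) :
    ∃ M₀ : ℕ, ∀ M ≥ M₀, ∀ x ∈ 𝒞.code, ∀ e : V → ZMod 2, hammingNorm e ≤ 5 →
      𝒞.pbf 3 2 M (x + e) = x := by
  refine ⟨2, fun M hM x hx e he => CHGLDPC.pbf_eq_of_iterate hcomp hx hM ?_⟩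
  have hcard : (CHGLDPC.errors x (x + e)).card ≤ 5 := by
    simpa [CHGLDPC.errors, hammingNorm] using he
  exact CHGLDPC.pbfStep_eq_of_card_errors_le_two hglobal.var_degree hcomp hsuper hx
    (CHGLDPC.card_errors_pbfStep_le_two hglobal.girth_eq.ge hglobal.var_degree hcomp hsuper hx
      hcard)
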